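/- Let $D\ge 1$, let $A$ be a Hermitian operator on $\mathbb{C}^D$ with non-degenerate spectrum, and let $|1\rangle,\dots,|D\rangle$ be an orthonormal basis of eigenvectors of $A$. Fix $x,k\in\{1,\dots,D\}$, real energies $E_1,\dots,E_D$ and a real time $t$. For a unitary matrix $C\in\mathbb{U}(D)$ let $H=H_C$ be the Hamiltonian whose matrix in the eigenbasis of $A$ is $C\,\mathrm{diag}(E_1,\dots,E_D)\,C^\dagger$, let $\rho(t)=e^{-itH}|x\rangle\langle x|e^{itH}$, and let $\Pr(k|\rho(t))=\mathrm{Tr}\big(|k\rangle\langle k|\rho(t)\big)$. Put $\mu(s)=\mathrm{Tr}\,e^{-isH}=\sum_{a=1}^D e^{-isE_a}$, which does not depend on $C$. Then the variance of $\Pr(k|\rho(t))$, when $C$ is distributed according to the Haar probability measure on $\mathbb{U}(D)$ and $E_1,\dots,E_D,t,x,k$ are fixed, is $$\mathbb{V}_C\{\Pr(k|\rho(t))\}=\frac1{D^4}\Big\{D^2-2D+4+(7-2D)\delta_{xk}+|\mu(t)|^2(2D\delta_{xk}-10\delta_{xk}-2)+\delta_{xk}|\mu(2t)|^2+2\delta_{xk}\,\mathrm{Re}\big[\mu(t)^2\mu(-2t)\big]\Big\}+R,$$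 where $R=O(D^{-5})$ as an expansion in powers of $1/D$ in which the traces $\mu$ are kept as coefficients. Precisely, there is a universal constant $K$ such that for all $D,A,E_1,\dots,E_D,t,x,k$ $$|R|\le \frac{K}{D^{5}}\left(1+|\mu(t)|^4+|\mu(2t)|^2\right).$$ In particular $R=O(D^{-5})$ as $D\to\infty$, uniformly over all Hamiltonians and times for which $|\mu(t)|$ and $|\mu(2t)|$ stay bounded. -/

import Mathlib

open Matrix MeasureTheory ProbabilityTheory

noncomputable section

namespace HaarVariance

/-- The group `𝕌(D)` of complex unitary `D × D` matrices. -/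
abbrev U (D : ℕ) : Type := Matrix.unitaryGroup (Fin D) ℂ

instance unitaryMeasurableSpace (D : ℕ) : MeasurableSpace (U D) := borel _

instance unitaryBorelSpace (D : ℕ) : BorelSpace (U D) := ⟨rfl⟩

/-- The set of unitary matrices is closed with entries in the closed unit disc, hence compact. -/
theorem isCompact_unitary (D : ℕ) :
    IsCompact (Matrix.unitaryGroup (Fin D) ℂ : Set (Matrix (Fin D) (Fin D) ℂ)) := by
  have hK : IsCompact (Set.univ.pi fun _ : Fin D => Set.univ.pi fun _ : Fin D =>
      Metric.closedBall (0 : ℂ) 1) :=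
    isCompact_univ_pi fun _ => isCompact_univ_pi fun _ => isCompact_closedBall _ _
  refine IsCompact.of_isClosed_subset hK isClosed_unitary ?_
  intro M hM i _ j _
  simpa using entry_norm_bound_of_unitary hM i j

instance unitaryCompactSpace (D : ℕ) : CompactSpace (U D) :=
  isCompact_iff_compactSpace.mp (isCompact_unitary D)

/-- The Haar probability measure on `𝕌(D)`: the Haar measure giving the whole group mass one. -/
def haar (D : ℕ) : Measure (U D) := Measure.haarMeasure ⊤

instance haarIsHaarMeasure (D : ℕ) : (haar D).IsHaarMeasure := by
  unfold haar; infer_instance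

instance haarIsProbabilityMeasure (D : ℕ) : IsProbabilityMeasure (haar D) :=
  ⟨Measure.haarMeasure_self (K₀ := (⊤ : TopologicalSpace.PositiveCompacts (U D)))⟩

/-- The rank-one operator `|v⟩⟨v|`. -/
def ketbra {D : ℕ} (v : EuclideanSpace ℂ (Fin D)) : Matrix (Fin D) (Fin D) ℂ :=
  Matrix.vecMulVec (fun i => v i) (fun i => star (v i))

/-- The Hamiltonian with energies `E` whose eigenbasis is related to the eigenbasis of the
observable `A` by the change of basis matrix `C`: in the eigenbasis of `A` its matrix is
`C diag(E) C†`, so its `a`-th eigenvector, with energy `E a`, is `∑ i, C i a • |i⟩`,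
where `|i⟩` is the `i`-th eigenvector of `A`. -/
def hamiltonian {D : ℕ} {A : Matrix (Fin D) (Fin D) ℂ} (hA : A.IsHermitian) (E : Fin D → ℝ)
    (C : U D) : Matrix (Fin D) (Fin D) ℂ :=
  let V : Matrix (Fin D) (Fin D) ℂ := hA.eigenvectorUnitary
  V * ((C : Matrix (Fin D) (Fin D) ℂ) * Matrix.diagonal (fun a => (E a : ℂ)) *
    (C : Matrix (Fin D) (Fin D) ℂ)ᴴ) * Vᴴ

/-- The time evolution `e^{-itH}` (matrix exponential, units with `ħ = 1`). -/
def evolution {D : ℕ} (H : Matrix (Fin D) (Fin D) ℂ) (t : ℝ) : Matrix (Fin D) (Fin D) ℂ :=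
  NormedSpace.exp ((-(Complex.I * (t : ℂ))) • H)

/-- The evolved state `ρ(t) = e^{-itH} ρ(0) (e^{-itH})†`. -/
def evolvedState {D : ℕ} (H ρ₀ : Matrix (Fin D) (Fin D) ℂ) (t : ℝ) :
    Matrix (Fin D) (Fin D) ℂ :=
  evolution H t * ρ₀ * (evolution H t)ᴴ

/-- The probability `Pr(k | ρ(t)) = Tr(|k⟩⟨k| ρ(t))` of the `k`-th outcome of a measurement of
the observable `A`, for the initial state `ρ(0) = |x⟩⟨x|` and the Hamiltonian with energies `E`
and change of basis matrix `C`, where `|x⟩`, `|k⟩` are eigenvectors of `A`. -/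
def outcomeProb {D : ℕ} {A : Matrix (Fin D) (Fin D) ℂ} (hA : A.IsHermitian) (E : Fin D → ℝ)
    (t : ℝ) (x k : Fin D) (C : U D) : ℝ :=
  (Matrix.trace (ketbra (hA.eigenvectorBasis k) *
    evolvedState (hamiltonian hA E C) (ketbra (hA.eigenvectorBasis x)) t)).re

/-- `F(t) = diag(e^{-i t E_a})`. -/
def F {D : ℕ} (E : Fin D → ℝ) (t : ℝ) : Matrix (Fin D) (Fin D) ℂ :=
  Matrix.diagonal fun a => Complex.exp (-(Complex.I * (t : ℂ) * (E a : ℂ)))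

/-- `μ(t) = Tr F(t)`. -/
def mu {D : ℕ} (E : Fin D → ℝ) (t : ℝ) : ℂ := Matrix.trace (F E t)

/-- Consistency of the definitions: `e^{-itH} = (V C) F(t) (V C)†`. -/
theorem evolution_hamiltonian {D : ℕ} {A : Matrix (Fin D) (Fin D) ℂ} (hA : A.IsHermitian)
    (E : Fin D → ℝ) (C : U D) (t : ℝ) :
    evolution (hamiltonian hA E C) t =
      ((hA.eigenvectorUnitary * C : U D) : Matrix (Fin D) (Fin D) ℂ) * F E t *
        ((hA.eigenvectorUnitary * C : U D) : Matrix (Fin D) (Fin D) ℂ)ᴴ := by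
  set W : U D := hA.eigenvectorUnitary * C with hW
  have h1 : (W : Matrix (Fin D) (Fin D) ℂ) * (W : Matrix (Fin D) (Fin D) ℂ)ᴴ = 1 :=
    Matrix.mem_unitaryGroup_iff.mp W.2
  have hinv : (W : Matrix (Fin D) (Fin D) ℂ)⁻¹ = (W : Matrix (Fin D) (Fin D) ℂ)ᴴ :=
    Matrix.inv_eq_right_inv h1
  have hu : IsUnit (W : Matrix (Fin D) (Fin D) ℂ) :=
    IsUnit.of_mul_eq_one _ h1
  have hH : (-(Complex.I * (t : ℂ))) • hamiltonian hA E C =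
      (W : Matrix (Fin D) (Fin D) ℂ) *
        Matrix.diagonal (fun a => -(Complex.I * (t : ℂ) * (E a : ℂ))) *
        (W : Matrix (Fin D) (Fin D) ℂ)⁻¹ := by
    have hd : Matrix.diagonal (fun a => -(Complex.I * (t : ℂ) * (E a : ℂ))) =
        (-(Complex.I * (t : ℂ))) • Matrix.diagonal (fun a => (E a : ℂ)) := by
      rw [← Matrix.diagonal_smul]
      congr 1
      funext a
      simp
    rw [hinv, hd, hW, hamiltonian]
    simp [Matrix.conjTranspose_mul, Matrix.mul_assoc]
  have hexp : NormedSpace.exp (fun a => -(Complex.I * (t : ℂ) * (E a : ℂ))) =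
      fun a => Complex.exp (-(Complex.I * (t : ℂ) * (E a : ℂ))) := by
    funext a
    rw [Pi.coe_exp, Complex.exp_eq_exp_ℂ]
  rw [evolution, hH, Matrix.exp_conj _ _ hu, Matrix.exp_diagonal, hinv, F, hexp]

/-- Consistency of the definitions: `μ(t) = Tr e^{-itH}`. -/
theorem trace_evolution_hamiltonian {D : ℕ} {A : Matrix (Fin D) (Fin D) ℂ}
    (hA : A.IsHermitian) (E : Fin D → ℝ) (C : U D) (t : ℝ) :
    Matrix.trace (evolution (hamiltonian hA E C) t) = mu E t := by
  have h2 : ((hA.eigenvectorUnitary * C : U D) : Matrix (Fin D) (Fin D) ℂ)ᴴ *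
      ((hA.eigenvectorUnitary * C : U D) : Matrix (Fin D) (Fin D) ℂ) = 1 :=
    Matrix.mem_unitaryGroup_iff'.mp (hA.eigenvectorUnitary * C : U D).2
  rw [evolution_hamiltonian, Matrix.trace_mul_comm, ← Matrix.mul_assoc, h2, Matrix.one_mul, mu]

end HaarVariance

end

/-!
In the eigenbasis of `A` the evolution is `C F C†` with `F = F(t)` a fixed diagonal unitary, so
`Pr(k | ρ(t)) = |(C F C†) k x|²`, and the variance only needs the second and fourth absolute moments
of one entry of `C F C†`. No Weingarten calculus is necessary: both moments have closed forms that
follow from the invariance of Haar measure, used infinitesimally.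

All functions involved are products of trace forms `C ↦ Tr (C M C† N)`. Replacing `C` by
`C exp(θX)` or `exp(θX) C`, with `X` skew-adjoint, leaves their Haar integral unchanged;
differentiating at `θ = 0` in the Banach algebra `C(U D, ℂ)` and extending by linearity to all
complex `X` shows that the sum over the factors, with `M` (or `N`) replaced by its commutator with
`X`, integrates to zero (`haarIntegral_sum_commutator_left_arg`,
`haarIntegral_sum_commutator_right_arg`).

* Diagonal entries `q M = (C M C†) x x`. Summing the right-invariance identity over the matrix units
  `X = E_ab`, with first factor `q (M E_ba)`, gives a recursion of Pólya urn type,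
  `(D + n) ∫ q M ∏ q Mᵢ = Tr M ∫ ∏ q Mᵢ + ∑ᵢ ∫ q (M Mᵢ) ∏_{j ≠ i} q Mⱼ`
  (`haarIntegral_conjEntry_recursion`, for `n = 3`), from which the moments of `|(C F C†) x x|²`
  follow exactly.
* Off-diagonal entries. Left invariance under unitaries that fix `e_x` relates the entries `j ≠ x`
  of column `x` of `C F C†` among each other: their squared moduli `p j` have equal means, and
  `∫ p k ^ 2 = 2 ∫ p k * p j`. As `∑_{j ≠ x} p j = 1 - p x`, the moments of `p k` are determined by
  those of `p x`.

Both exact variances are combinations of `1`, `m = |μ(t)|²`, `m²` and `|μ(2t)|² + 2 Re[μ(t)²μ(-2t)]`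
with coefficients rational in `D`; comparing each coefficient with its leading part in `D⁻¹` leaves
at most `100 / D⁵` each.
-/

noncomputable section

namespace HaarVariance

/-! ### Infinitesimal invariance of Haar measure -/

/-- A right translate of the Haar probability measure is again a left Haar probability measure, and
there is only one. -/
theorem haar_isMulRightInvariant (D : ℕ) : (haar D).IsMulRightInvariant := by
  refine ⟨fun g => ?_⟩
  have : IsProbabilityMeasure ((haar D).map (· * g)) :=
    Measure.isProbabilityMeasure_map (by fun_prop)
  have h2 : ((haar D).map (· * g)).IsHaarMeasure := inferInstance
  exact Measure.isHaarMeasure_eq_of_isProbabilityMeasure _ _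

/-- The Haar integral of continuous functions on `𝕌(D)`, as a continuous linear functional. -/
def haarIntegral (D : ℕ) : C(U D, ℂ) →L[ℂ] ℂ :=
  LinearMap.mkContinuous
    { toFun := fun f => ∫ C, f C ∂haar D
      map_add' := fun f g => by
        simpa using integral_add (f.continuous.integrable_of_hasCompactSupport
          (HasCompactSupport.of_compactSpace f)) (g.continuous.integrable_of_hasCompactSupport
          (HasCompactSupport.of_compactSpace g))
      map_smul' := fun c f => by simpa using integral_const_mul c f } 1 fun f => by
    simpa using norm_integral_le_of_norm_le_const (μ := haar D) (C := ‖f‖)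
      (Filter.Eventually.of_forall fun C => f.norm_coe_le_norm C)

theorem haarIntegral_apply {D : ℕ} (f : C(U D, ℂ)) : haarIntegral D f = ∫ C, f C ∂haar D := rfl

/-- The function `C ↦ Tr (C M C† N)` on `𝕌(D)`, bilinear in `(M, N)`. Right translation of `C` acts
by conjugation on `M`, left translation by conjugation on `N`. -/
def traceForm {D : ℕ} : Matrix (Fin D) (Fin D) ℂ →ₗ[ℂ] Matrix (Fin D) (Fin D) ℂ →ₗ[ℂ] C(U D, ℂ) :=
  LinearMap.mk₂ ℂ
    (fun M N => ⟨fun C => Matrix.trace ((C : Matrix (Fin D) (Fin D) ℂ) * M *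
      (C : Matrix (Fin D) (Fin D) ℂ)ᴴ * N), by fun_prop⟩)
    (fun M M' N => by ext C; simp [Matrix.mul_add, Matrix.add_mul])
    (fun c M N => by ext C; simp)
    (fun M N N' => by ext C; simp [Matrix.mul_add])
    (fun c M N => by ext C; simp)

theorem traceForm_apply {D : ℕ} (M N : Matrix (Fin D) (Fin D) ℂ) (C : U D) :
    traceForm M N C = Matrix.trace ((C : Matrix (Fin D) (Fin D) ℂ) * M *
      (C : Matrix (Fin D) (Fin D) ℂ)ᴴ * N) := rfl

open scoped Matrix.Norms.L2Operator in
/-- If `∫ ∏ L i (M i)` is unchanged when all `M i` are conjugated by the same unitary, its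
derivative along the conjugations by `exp(θX)` vanishes. -/
theorem haarIntegral_sum_commutator_of_skewAdjoint {D : ℕ} {ι : Type*} [Fintype ι] [DecidableEq ι]
    (L : ι → Matrix (Fin D) (Fin D) ℂ →ₗ[ℂ] C(U D, ℂ))
    (hL : ∀ (R : U D) (M : ι → Matrix (Fin D) (Fin D) ℂ),
      haarIntegral D (∏ i, L i ((R : Matrix (Fin D) (Fin D) ℂ) * M i *
        (R : Matrix (Fin D) (Fin D) ℂ)ᴴ)) = haarIntegral D (∏ i, L i (M i)))
    (M : ι → Matrix (Fin D) (Fin D) ℂ) {X : Matrix (Fin D) (Fin D) ℂ}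
    (hX : X ∈ skewAdjoint (Matrix (Fin D) (Fin D) ℂ)) :
    haarIntegral D (∑ i, (∏ j ∈ Finset.univ.erase i, L j (M j)) *
      L i (X * M i - M i * X)) = 0 := by
  let _ : NormedAlgebra ℚ (Matrix (Fin D) (Fin D) ℂ) := NormedAlgebra.restrictScalars ℚ ℝ _
  have hmem : ∀ θ : ℝ, NormedSpace.exp (θ • X) ∈ Matrix.unitaryGroup (Fin D) ℂ := fun θ =>
    NormedSpace.exp_mem_unitary_of_mem_skewAdjoint ((skewAdjoint.submodule ℝ _).smul_mem θ hX)
  have hstar : ∀ θ : ℝ, (NormedSpace.exp (θ • X))ᴴ = NormedSpace.exp (θ • (-X)) := fun θ => by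
    rw [← Matrix.exp_conjTranspose, Matrix.conjTranspose_smul, star_trivial,
      ← star_eq_conjTranspose, skewAdjoint.mem_iff.mp hX]
  have hcurve : ∀ i, HasDerivAt (fun θ : ℝ => L i (NormedSpace.exp (θ • X) * M i *
      (NormedSpace.exp (θ • X))ᴴ)) (L i (X * M i - M i * X)) 0 := fun i => by
    simp only [hstar]
    have h1 : HasDerivAt (fun θ : ℝ => NormedSpace.exp (θ • X)) X 0 := by
      simpa using hasDerivAt_exp_smul_const (𝕂 := ℝ) X 0
    have h2 : HasDerivAt (fun θ : ℝ => NormedSpace.exp (θ • (-X))) (-X) 0 := by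
      simpa using hasDerivAt_exp_smul_const (𝕂 := ℝ) (-X) 0
    have h3 := (h1.mul_const (M i)).mul h2
    have h4 :=
      ((LinearMap.toContinuousLinearMap (L i)).restrictScalars ℝ).hasFDerivAt.comp_hasDerivAt
        (0 : ℝ) h3
    simpa [sub_eq_add_neg, Function.comp_def] using h4
  have hprod := HasDerivAt.fun_finsetProd (u := Finset.univ) fun i _ => hcurve i
  have hint := ((haarIntegral D).restrictScalars ℝ).hasFDerivAt.comp_hasDerivAt (0 : ℝ) hprod
  have hconst : (⇑((haarIntegral D).restrictScalars ℝ) ∘ fun θ : ℝ => ∏ i, L i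
      (NormedSpace.exp (θ • X) * M i * (NormedSpace.exp (θ • X))ᴴ)) =
      fun _ => haarIntegral D (∏ i, L i (M i)) := by
    funext θ
    exact hL ⟨_, hmem θ⟩ M
  rw [hconst] at hint
  have := hint.unique (hasDerivAt_const _ _)
  simpa using this

/-- The derivative is complex linear in `X`, and the skew-adjoint matrices span all matrices
over `ℂ`. -/
theorem haarIntegral_sum_commutator {D : ℕ} {ι : Type*} [Fintype ι] [DecidableEq ι]
    (L : ι → Matrix (Fin D) (Fin D) ℂ →ₗ[ℂ] C(U D, ℂ))
    (hL : ∀ (R : U D) (M : ι → Matrix (Fin D) (Fin D) ℂ),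
      haarIntegral D (∏ i, L i ((R : Matrix (Fin D) (Fin D) ℂ) * M i *
        (R : Matrix (Fin D) (Fin D) ℂ)ᴴ)) = haarIntegral D (∏ i, L i (M i)))
    (M : ι → Matrix (Fin D) (Fin D) ℂ) (X : Matrix (Fin D) (Fin D) ℂ) :
    haarIntegral D (∑ i, (∏ j ∈ Finset.univ.erase i, L j (M j)) *
      L i (X * M i - M i * X)) = 0 := by
  let J : Matrix (Fin D) (Fin D) ℂ →ₗ[ℂ] ℂ := (haarIntegral D).toLinearMap ∘ₗ
    ∑ i, LinearMap.mulLeft ℂ (∏ j ∈ Finset.univ.erase i, L j (M j)) ∘ₗ L i ∘ₗ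
      (LinearMap.mulRight ℂ (M i) - LinearMap.mulLeft ℂ (M i))
  have hJ : ∀ Y, J Y = haarIntegral D (∑ i, (∏ j ∈ Finset.univ.erase i, L j (M j)) *
      L i (Y * M i - M i * Y)) := fun Y => by simp [J]
  have hskew : ∀ Y ∈ skewAdjoint (Matrix (Fin D) (Fin D) ℂ), J Y = 0 := fun Y hY => by
    rw [hJ]; exact haarIntegral_sum_commutator_of_skewAdjoint L hL M hY
  have h1 : J (X - star X) = 0 := hskew _ (by simp [skewAdjoint.mem_iff])
  have h2 : J (Complex.I • (X + star X)) = 0 := hskew _ (by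
    simp [skewAdjoint.mem_iff, add_comm])
  rw [← hJ]
  -- Both `X - X†` and `I (X + X†)` are skew-adjoint.
  have h3 : X = (1 / 2 : ℂ) • ((X - star X) - Complex.I • (Complex.I • (X + star X))) := by
    rw [smul_smul, Complex.I_mul_I]
    module
  rw [h3, map_smul, map_sub, map_smul, h1, h2]
  simp

/-- Infinitesimal right invariance of Haar measure. -/
theorem haarIntegral_sum_commutator_left_arg {D : ℕ} {ι : Type*} [Fintype ι] [DecidableEq ι]
    (M N : ι → Matrix (Fin D) (Fin D) ℂ) (X : Matrix (Fin D) (Fin D) ℂ) :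
    haarIntegral D (∑ i, (∏ j ∈ Finset.univ.erase i, traceForm (M j) (N j)) *
      traceForm (X * M i - M i * X) (N i)) = 0 := by
  have := haar_isMulRightInvariant D
  refine haarIntegral_sum_commutator (fun i => traceForm.flip (N i)) (fun R M => ?_) M X
  rw [haarIntegral_apply, haarIntegral_apply,
    ← integral_mul_right_eq_self (fun C => (∏ i, traceForm.flip (N i) (M i)) C) R]
  congr 1 with C
  simp [ContinuousMap.prod_apply, traceForm_apply, Matrix.mul_assoc]

/-- Infinitesimal left invariance of Haar measure. -/
theorem haarIntegral_sum_commutator_right_arg {D : ℕ} {ι : Type*} [Fintype ι] [DecidableEq ι]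
    (M N : ι → Matrix (Fin D) (Fin D) ℂ) (X : Matrix (Fin D) (Fin D) ℂ) :
    haarIntegral D (∑ i, (∏ j ∈ Finset.univ.erase i, traceForm (M j) (N j)) *
      traceForm (M i) (X * N i - N i * X)) = 0 := by
  refine haarIntegral_sum_commutator (fun i => traceForm (M i)) (fun R N => ?_) N X
  rw [haarIntegral_apply, haarIntegral_apply,
    ← integral_mul_left_eq_self (fun C => (∏ i, traceForm (M i) (N i)) C) R⁻¹]
  congr 1 with C
  simp only [ContinuousMap.prod_apply, traceForm_apply]
  refine Finset.prod_congr rfl fun i _ => ?_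
  have : ((R⁻¹ : U D) : Matrix (Fin D) (Fin D) ℂ) = (R : Matrix (Fin D) (Fin D) ℂ)ᴴ := rfl
  simp only [Submonoid.coe_mul, this, Matrix.conjTranspose_mul, Matrix.conjTranspose_conjTranspose]
  simp only [← Matrix.mul_assoc]
  rw [Matrix.trace_mul_comm]
  simp only [Matrix.mul_assoc]

/-! ### The recursion for diagonal entries -/

/-- The entry `C ↦ (C M C†) i j`, linear in `M`, encoded as the trace form of `M` and the matrix
unit `E_ji`. -/
def conjEntry {D : ℕ} (i j : Fin D) : Matrix (Fin D) (Fin D) ℂ →ₗ[ℂ] C(U D, ℂ) :=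
  traceForm.flip (Matrix.single j i 1)

theorem conjEntry_eq_traceForm {D : ℕ} (i j : Fin D) (M : Matrix (Fin D) (Fin D) ℂ) :
    conjEntry i j M = traceForm M (Matrix.single j i 1) := rfl

theorem conjEntry_apply {D : ℕ} (i j : Fin D) (M : Matrix (Fin D) (Fin D) ℂ) (C : U D) :
    conjEntry i j M C = ((C : Matrix (Fin D) (Fin D) ℂ) * M *
      (C : Matrix (Fin D) (Fin D) ℂ)ᴴ) i j := by
  rw [conjEntry_eq_traceForm, traceForm_apply, Matrix.trace_mul_single, MulOpposite.op_one,
    one_smul]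

theorem unitary_conjTranspose_mul {D : ℕ} (C : U D) :
    (C : Matrix (Fin D) (Fin D) ℂ)ᴴ * (C : Matrix (Fin D) (Fin D) ℂ) = 1 :=
  Matrix.mem_unitaryGroup_iff'.mp C.2

theorem unitary_mul_conjTranspose {D : ℕ} (C : U D) :
    (C : Matrix (Fin D) (Fin D) ℂ) * (C : Matrix (Fin D) (Fin D) ℂ)ᴴ = 1 :=
  Matrix.mem_unitaryGroup_iff.mp C.2

theorem conjEntry_one {D : ℕ} (x : Fin D) : conjEntry x x 1 = 1 := by
  ext C
  simp [conjEntry_apply, unitary_mul_conjTranspose]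

theorem sum_commutator_single {D : ℕ} (M : Matrix (Fin D) (Fin D) ℂ) :
    ∑ a : Fin D, ∑ b : Fin D, (Matrix.single a b 1 * (M * Matrix.single b a 1) -
      M * Matrix.single b a 1 * Matrix.single a b 1) =
      Matrix.trace M • (1 : Matrix (Fin D) (Fin D) ℂ) - (D : ℂ) • M := by
  have h1 : ∀ a b : Fin D, Matrix.single a b (1 : ℂ) * (M * Matrix.single b a 1) =
      M b b • Matrix.single a a 1 := fun a b => by
    rw [← Matrix.mul_assoc, Matrix.single_mul_mul_single]
    simp
  have h2 : ∀ a b : Fin D, M * Matrix.single b a 1 * Matrix.single a b 1 =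
      M * Matrix.single b b 1 := fun a b => by
    rw [Matrix.mul_assoc, Matrix.single_mul_single_same, one_mul]
  simp only [h1, h2, Finset.sum_sub_distrib, ← Finset.sum_smul, ← Finset.smul_sum,
    ← Finset.mul_sum, Matrix.sum_single_one]
  simp [Matrix.trace, Nat.cast_smul_eq_nsmul, (Nat.cast_commute D M).eq]

theorem mul_single_mul_apply {D : ℕ} (P R : Matrix (Fin D) (Fin D) ℂ) (a b i j : Fin D) :
    (P * Matrix.single a b (1 : ℂ) * R : Matrix (Fin D) (Fin D) ℂ) i j = P i a * R b j := by
  rw [Matrix.single_eq_single_vecMulVec_single, Matrix.mul_vecMulVec, Matrix.vecMulVec_mul,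
    Matrix.vecMulVec_apply]
  simp

theorem sum_conjEntry_mul_conjEntry_commutator {D : ℕ} (x : Fin D)
    (M N : Matrix (Fin D) (Fin D) ℂ) :
    ∑ a : Fin D, ∑ b : Fin D, conjEntry x x (M * Matrix.single b a 1) *
      conjEntry x x (Matrix.single a b 1 * N - N * Matrix.single a b 1) =
      conjEntry x x (M * N) - conjEntry x x M * conjEntry x x N := by
  ext C
  let P : Matrix (Fin D) (Fin D) ℂ := C
  have h1 : ∀ a b : Fin D, conjEntry x x (M * Matrix.single b a 1) C =
      (P * M) x b * Pᴴ a x := fun a b => by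
    rw [conjEntry_apply, ← Matrix.mul_assoc, mul_single_mul_apply]
  have h2 : ∀ a b : Fin D, conjEntry x x (Matrix.single a b 1 * N) C =
      P x a * (N * Pᴴ) b x := fun a b => by
    rw [conjEntry_apply, ← Matrix.mul_assoc, Matrix.mul_assoc, mul_single_mul_apply]
  have h3 : ∀ a b : Fin D, conjEntry x x (N * Matrix.single a b 1) C =
      (P * N) x a * Pᴴ b x := fun a b => by
    rw [conjEntry_apply, ← Matrix.mul_assoc, mul_single_mul_apply]
  have h4 : conjEntry x x (M * N) C = ∑ b, (P * M) x b * (N * Pᴴ) b x := by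
    rw [conjEntry_apply, ← Matrix.mul_assoc, Matrix.mul_assoc, Matrix.mul_apply]
  have h5 : ∀ Q : Matrix (Fin D) (Fin D) ℂ, conjEntry x x Q C = ∑ b, (P * Q) x b * Pᴴ b x :=
    fun Q => by rw [conjEntry_apply, Matrix.mul_apply]
  have h6 : ∑ a, P x a * Pᴴ a x = 1 := by
    rw [← Matrix.mul_apply, unitary_mul_conjTranspose, Matrix.one_apply_eq]
  simp only [ContinuousMap.coe_sum, Finset.sum_apply, ContinuousMap.mul_apply, map_sub,
    ContinuousMap.sub_apply, h1, h2, h3, h4]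
  rw [mul_comm (conjEntry x x M C), h5 M, h5 N, Finset.sum_mul_sum,
    ← one_mul (∑ b, (P * M) x b * (N * Pᴴ) b x), ← h6, Finset.sum_mul_sum,
    ← Finset.sum_sub_distrib]
  refine Finset.sum_congr rfl fun a _ => ?_
  rw [← Finset.sum_sub_distrib]
  refine Finset.sum_congr rfl fun b _ => ?_
  ring

/-- The urn recursion for products of four diagonal entries. Shorter products are the case where
some of the `Mᵢ` are `1`, as `conjEntry x x 1 = 1`. -/
theorem haarIntegral_conjEntry_recursion {D : ℕ} (x : Fin D)
    (M M₁ M₂ M₃ : Matrix (Fin D) (Fin D) ℂ) :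
    (D + 3) * haarIntegral D
        (conjEntry x x M * conjEntry x x M₁ * conjEntry x x M₂ * conjEntry x x M₃) =
      Matrix.trace M * haarIntegral D (conjEntry x x M₁ * conjEntry x x M₂ * conjEntry x x M₃) +
      haarIntegral D (conjEntry x x (M * M₁) * conjEntry x x M₂ * conjEntry x x M₃) +
      haarIntegral D (conjEntry x x M₁ * conjEntry x x (M * M₂) * conjEntry x x M₃) +
      haarIntegral D (conjEntry x x M₁ * conjEntry x x M₂ * conjEntry x x (M * M₃)) := by
  set q := conjEntry x x with hq
  have key : ∀ a b : Fin D, haarIntegral D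
      (q (Matrix.single a b 1 * (M * Matrix.single b a 1) -
          M * Matrix.single b a 1 * Matrix.single a b 1) * (q M₁ * q M₂ * q M₃) +
        (q (M * Matrix.single b a 1) *
          q (Matrix.single a b 1 * M₁ - M₁ * Matrix.single a b 1)) * (q M₂ * q M₃) +
        (q (M * Matrix.single b a 1) *
          q (Matrix.single a b 1 * M₂ - M₂ * Matrix.single a b 1)) * (q M₁ * q M₃) +
        (q (M * Matrix.single b a 1) *
          q (Matrix.single a b 1 * M₃ - M₃ * Matrix.single a b 1)) * (q M₁ * q M₂)) = 0 := by
    intro a b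
    rw [← haarIntegral_sum_commutator_left_arg ![M * Matrix.single b a 1, M₁, M₂, M₃]
      (fun _ => Matrix.single x x 1) (Matrix.single a b 1)]
    have e0 : (Finset.univ : Finset (Fin 4)).erase 0 = {1, 2, 3} := by decide
    have e1 : (Finset.univ : Finset (Fin 4)).erase 1 = {0, 2, 3} := by decide
    have e2 : (Finset.univ : Finset (Fin 4)).erase 2 = {0, 1, 3} := by decide
    have e3 : (Finset.univ : Finset (Fin 4)).erase 3 = {0, 1, 2} := by decide
    simp only [Fin.sum_univ_four, e0, e1, e2, e3, ← conjEntry_eq_traceForm, ← hq]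
    simp
    ring_nf
  have hsum := Finset.sum_eq_zero fun (a : Fin D) (_ : a ∈ Finset.univ) =>
    Finset.sum_eq_zero fun (b : Fin D) (_ : b ∈ Finset.univ) => key a b
  simp only [← map_sum (haarIntegral D), Finset.sum_add_distrib, ← Finset.sum_mul] at hsum
  simp only [hq, sum_conjEntry_mul_conjEntry_commutator] at hsum
  simp only [← hq, ← map_sum q, sum_commutator_single] at hsum
  simp only [map_sub, map_smul, map_add, sub_mul, smul_mul_assoc, hq, conjEntry_one,
    one_mul] at hsum
  simp only [← hq, smul_eq_mul] at hsum
  have r1 : q M * q M₁ * (q M₂ * q M₃) = q M * q M₁ * q M₂ * q M₃ := by ring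
  have r2 : q M * q M₂ * (q M₁ * q M₃) = q M * q M₁ * q M₂ * q M₃ := by ring
  have r3 : q M * q M₃ * (q M₁ * q M₂) = q M * q M₁ * q M₂ * q M₃ := by ring
  have r4 : q M * (q M₁ * q M₂ * q M₃) = q M * q M₁ * q M₂ * q M₃ := by ring
  have r5 : q (M * M₁) * (q M₂ * q M₃) = q (M * M₁) * q M₂ * q M₃ := by ring
  have r6 : q (M * M₂) * (q M₁ * q M₃) = q M₁ * q (M * M₂) * q M₃ := by ring
  have r7 : q (M * M₃) * (q M₁ * q M₂) = q M₁ * q M₂ * q (M * M₃) := by ring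
  rw [r1, r2, r3, r4, r5, r6, r7] at hsum
  linear_combination -hsum

/-! ### Moments of diagonal and off-diagonal entries -/

theorem haarIntegral_one {D : ℕ} : haarIntegral D 1 = 1 := by
  simp [haarIntegral_apply]

section Diagonal

variable {D : ℕ} (x : Fin D)

theorem haarIntegral_conjEntry_recursion_three (M M₁ M₂ : Matrix (Fin D) (Fin D) ℂ) :
    (D + 2) * haarIntegral D (conjEntry x x M * conjEntry x x M₁ * conjEntry x x M₂) =
      Matrix.trace M * haarIntegral D (conjEntry x x M₁ * conjEntry x x M₂) +
      haarIntegral D (conjEntry x x (M * M₁) * conjEntry x x M₂) +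
      haarIntegral D (conjEntry x x M₁ * conjEntry x x (M * M₂)) := by
  have h := haarIntegral_conjEntry_recursion x M M₁ M₂ 1
  simp only [conjEntry_one, mul_one] at h
  rw [show conjEntry x x M₁ * conjEntry x x M₂ * conjEntry x x M =
    conjEntry x x M * conjEntry x x M₁ * conjEntry x x M₂ by ring] at h
  linear_combination h

theorem haarIntegral_conjEntry_recursion_two (M M₁ : Matrix (Fin D) (Fin D) ℂ) :
    (D + 1) * haarIntegral D (conjEntry x x M * conjEntry x x M₁) =
      Matrix.trace M * haarIntegral D (conjEntry x x M₁) +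
      haarIntegral D (conjEntry x x (M * M₁)) := by
  have h := haarIntegral_conjEntry_recursion_three x M M₁ 1
  simp only [conjEntry_one, mul_one] at h
  rw [mul_comm (conjEntry x x M₁)] at h
  linear_combination h

theorem haarIntegral_conjEntry (M : Matrix (Fin D) (Fin D) ℂ) :
    D * haarIntegral D (conjEntry x x M) = Matrix.trace M := by
  have h := haarIntegral_conjEntry_recursion_two x M 1
  simp only [conjEntry_one, mul_one, haarIntegral_one] at h
  linear_combination h

theorem haarIntegral_diag_second_moment {M N : Matrix (Fin D) (Fin D) ℂ} (hMN : M * N = 1) :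
    (D * (D + 1) : ℂ) * haarIntegral D (conjEntry x x M * conjEntry x x N) =
      Matrix.trace M * Matrix.trace N + D := by
  have h := haarIntegral_conjEntry_recursion_two x M N
  rw [hMN, conjEntry_one, haarIntegral_one] at h
  linear_combination (D : ℂ) * h + Matrix.trace M * haarIntegral_conjEntry x N

/-- For `N = M† = M⁻¹` this is the fourth absolute moment of a diagonal entry of `C M C†`. -/
theorem haarIntegral_diag_fourth_moment {M N : Matrix (Fin D) (Fin D) ℂ} (hMN : M * N = 1) :
    (D * (D + 1) * (D + 2) * (D + 3) : ℂ) *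
        haarIntegral D ((conjEntry x x M * conjEntry x x N) ^ 2) =
      (Matrix.trace M * Matrix.trace N) ^ 2 + Matrix.trace (M * M) * Matrix.trace N ^ 2 +
        Matrix.trace M ^ 2 * Matrix.trace (N * N) + Matrix.trace (M * M) * Matrix.trace (N * N) +
        (4 * D + 8) * (Matrix.trace M * Matrix.trace N) + 2 * D ^ 2 + 6 * D := by
  have hMMN : M * M * N = M := by rw [Matrix.mul_assoc, hMN, Matrix.mul_one]
  have h4 := haarIntegral_conjEntry_recursion x M M N N
  have h3 := haarIntegral_conjEntry_recursion_three x M N N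
  have h3' := haarIntegral_conjEntry_recursion_three x (M * M) N N
  have h2 := haarIntegral_conjEntry_recursion_two x M N
  have h2' := haarIntegral_conjEntry_recursion_two x N N
  have h1' := haarIntegral_conjEntry x N
  have h1'' := haarIntegral_conjEntry x (N * N)
  simp only [hMN, hMMN, conjEntry_one, mul_one, one_mul, haarIntegral_one] at h4 h3 h3' h2
  rw [mul_comm (conjEntry x x N) (conjEntry x x M)] at h3'
  rw [show (conjEntry x x M * conjEntry x x N) ^ 2 =
    conjEntry x x M * conjEntry x x M * conjEntry x x N * conjEntry x x N by ring]
  linear_combination (D * (D + 1) * (D + 2) : ℂ) * h4 + D * (D + 1) * Matrix.trace M * h3 +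
    D * (D + 1) * h3' + 2 * D * (D + 3) * h2 +
    D * (Matrix.trace M ^ 2 + Matrix.trace (M * M)) * h2' +
    (Matrix.trace M * (4 * D + 8) +
      Matrix.trace N * (Matrix.trace M ^ 2 + Matrix.trace (M * M))) * h1' +
    (Matrix.trace M ^ 2 + Matrix.trace (M * M)) * h1''

end Diagonal

section OffDiagonal

variable {D : ℕ}

/-- For `N = M†`: the off-diagonal entries in column `x` of `C M C†` have equal second absolute
moments. -/
theorem haarIntegral_offDiag_eq (M N : Matrix (Fin D) (Fin D) ℂ) {x j k : Fin D}
    (hj : j ≠ x) (hk : k ≠ x) :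
    haarIntegral D (conjEntry k x M * conjEntry x k N) =
      haarIntegral D (conjEntry j x M * conjEntry x j N) := by
  rcases eq_or_ne j k with rfl | hjk
  · rfl
  have h := haarIntegral_sum_commutator_right_arg ![M, N]
    ![Matrix.single x k 1, Matrix.single j x 1] (Matrix.single k j 1)
  -- `X = E_kj` annihilates `e_x`, moves `r k` to `-r j` and `r̄ j` to `r̄ k`.
  have e0 : (Finset.univ : Finset (Fin 2)).erase 0 = {1} := by decide
  have e1 : (Finset.univ : Finset (Fin 2)).erase 1 = {0} := by decide
  simp [Fin.sum_univ_two, e0, e1, hj, hk.symm, ← conjEntry_eq_traceForm] at h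
  rw [mul_comm (conjEntry x j N)] at h
  linear_combination h

/-- For `N = M†`: the off-diagonal entries of column `x` of `C M C†` have the mixed moments of a
unitarily invariant random vector, for which `𝔼|r k|⁴ = 2 𝔼|r k|²|r j|²`. -/
theorem haarIntegral_offDiag_sq_sq_eq_two_mul (M N : Matrix (Fin D) (Fin D) ℂ) {x j k : Fin D}
    (hj : j ≠ x) (hk : k ≠ x) (hjk : j ≠ k) :
    haarIntegral D ((conjEntry k x M * conjEntry x k N) ^ 2) =
      2 * haarIntegral D
        ((conjEntry k x M * conjEntry x k N) * (conjEntry j x M * conjEntry x j N)) := by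
  have h := haarIntegral_sum_commutator_right_arg ![M, M, N, N]
    ![Matrix.single x k 1, Matrix.single x k 1, Matrix.single k x 1, Matrix.single j x 1]
    (Matrix.single k j 1)
  -- With `r l = (C M C†) l x`, this is the derivative of `r k * r k * r̄ k * r̄ j`
  -- along `X = E_kj`.
  have e0 : (Finset.univ : Finset (Fin 4)).erase 0 = {1, 2, 3} := by decide
  have e1 : (Finset.univ : Finset (Fin 4)).erase 1 = {0, 2, 3} := by decide
  have e2 : (Finset.univ : Finset (Fin 4)).erase 2 = {0, 1, 3} := by decide
  have e3 : (Finset.univ : Finset (Fin 4)).erase 3 = {0, 1, 2} := by decide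
  simp [Fin.sum_univ_four, e0, e1, e2, e3, hj, hk.symm, hjk,
    ← conjEntry_eq_traceForm] at h
  rw [show conjEntry k x M * (conjEntry x k N * conjEntry x j N) * conjEntry j x M =
      conjEntry k x M * conjEntry x k N * (conjEntry j x M * conjEntry x j N) by ring,
    show conjEntry k x M * (conjEntry k x M * conjEntry x k N) * conjEntry x k N =
      (conjEntry k x M * conjEntry x k N) ^ 2 by ring] at h
  linear_combination h

/-- For `N = M† = M⁻¹`: column `x` of the unitary `C M C†` has norm one. -/
theorem sum_conjEntry_mul_conjEntry {M N : Matrix (Fin D) (Fin D) ℂ} (hNM : N * M = 1)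
    (x : Fin D) : ∑ j, conjEntry j x M * conjEntry x j N = 1 := by
  ext C
  simp only [ContinuousMap.coe_sum, Finset.sum_apply, ContinuousMap.mul_apply, conjEntry_apply]
  rw [Finset.sum_congr rfl fun j _ => mul_comm _ _, ← Matrix.mul_apply]
  have : (C : Matrix (Fin D) (Fin D) ℂ) * N * (C : Matrix (Fin D) (Fin D) ℂ)ᴴ *
      (C * M * (C : Matrix (Fin D) (Fin D) ℂ)ᴴ) = 1 := by
    calc _ = (C : Matrix (Fin D) (Fin D) ℂ) * (N * ((C : Matrix (Fin D) (Fin D) ℂ)ᴴ * C) * M) *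
          (C : Matrix (Fin D) (Fin D) ℂ)ᴴ := by simp only [Matrix.mul_assoc]
      _ = 1 := by
        rw [unitary_conjTranspose_mul, Matrix.mul_one, hNM, Matrix.mul_one,
          unitary_mul_conjTranspose]
  rw [this]; simp

theorem haarIntegral_offDiag_second_moment {M N : Matrix (Fin D) (Fin D) ℂ} (hNM : N * M = 1)
    {x k : Fin D} (hk : k ≠ x) :
    (D - 1 : ℂ) * haarIntegral D (conjEntry k x M * conjEntry x k N) =
      1 - haarIntegral D (conjEntry x x M * conjEntry x x N) := by
  have h := congrArg (haarIntegral D) (sum_conjEntry_mul_conjEntry hNM x)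
  rw [map_sum, haarIntegral_one, ← Finset.add_sum_erase _ _ (Finset.mem_univ x),
    Finset.sum_congr rfl fun j hj =>
      haarIntegral_offDiag_eq M N hk (Finset.ne_of_mem_erase hj), Finset.sum_const,
    Finset.card_erase_of_mem (Finset.mem_univ x), Finset.card_univ, Fintype.card_fin,
    nsmul_eq_mul, Nat.cast_sub x.pos, Nat.cast_one] at h
  linear_combination h

theorem haarIntegral_offDiag_fourth_moment {M N : Matrix (Fin D) (Fin D) ℂ} (hNM : N * M = 1)
    {x k : Fin D} (hk : k ≠ x) :
    (D * (D - 1) : ℂ) * haarIntegral D ((conjEntry k x M * conjEntry x k N) ^ 2) =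
      2 * (1 - 2 * haarIntegral D (conjEntry x x M * conjEntry x x N) +
        haarIntegral D ((conjEntry x x M * conjEntry x x N) ^ 2)) := by
  set p : Fin D → C(U D, ℂ) := fun j => conjEntry j x M * conjEntry x j N with hp
  have hcard : ∀ y ∈ Finset.univ.erase x, (((Finset.univ.erase x).erase y).card : ℂ) = D - 2 :=
    fun y hy => by
      have : ((Finset.univ.erase x).erase y).card + 2 = D := by
        rw [Finset.card_erase_of_mem hy, Finset.card_erase_of_mem (Finset.mem_univ x),
          Finset.card_univ, Fintype.card_fin]
        have := Finset.card_pos.mpr ⟨y, hy⟩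
        rw [Finset.card_erase_of_mem (Finset.mem_univ x), Finset.card_univ,
          Fintype.card_fin] at this
        omega
      have h := congrArg (Nat.cast (R := ℂ)) this
      push_cast at h
      linear_combination h
  have hsame : ∀ j, j ≠ x → haarIntegral D (p j ^ 2) = haarIntegral D (p k ^ 2) := fun j hj => by
    rcases eq_or_ne j k with rfl | hjk
    · rfl
    rw [haarIntegral_offDiag_sq_sq_eq_two_mul M N hk hj hjk.symm,
      haarIntegral_offDiag_sq_sq_eq_two_mul M N hj hk hjk, mul_comm (conjEntry j x M * _)]
  have hrow : ∀ j ∈ Finset.univ.erase x, haarIntegral D (p j * ∑ l ∈ Finset.univ.erase x, p l) =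
      D / 2 * haarIntegral D (p k ^ 2) := fun j hj => by
    have hjx := Finset.ne_of_mem_erase hj
    rw [← Finset.add_sum_erase _ _ hj, mul_add, Finset.mul_sum, map_add, map_sum, ← sq, hsame j hjx,
      Finset.sum_congr rfl (g := fun _ => haarIntegral D (p k ^ 2) / 2) fun l hl => by
        have hlx := Finset.ne_of_mem_erase (Finset.mem_of_mem_erase hl)
        have := haarIntegral_offDiag_sq_sq_eq_two_mul M N hlx hjx (Finset.ne_of_mem_erase hl)
        rw [← hsame j hjx]
        linear_combination this / (-2), Finset.sum_const, nsmul_eq_mul, hcard j hj]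
    ring
  have hS : ∑ l ∈ Finset.univ.erase x, p l = 1 - p x := by
    rw [← sum_conjEntry_mul_conjEntry hNM x, ← Finset.add_sum_erase _ _ (Finset.mem_univ x)]
    simp [hp]
  have htot : haarIntegral D ((1 - p x) * (1 - p x)) =
      (D - 1) * (D / 2 * haarIntegral D (p k ^ 2)) := by
    rw [← hS]
    nth_rewrite 1 [Finset.sum_mul]
    rw [map_sum, Finset.sum_congr rfl hrow, Finset.sum_const,
      Finset.card_erase_of_mem (Finset.mem_univ x), Finset.card_univ, Fintype.card_fin,
      nsmul_eq_mul, Nat.cast_sub x.pos, Nat.cast_one]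
  have hexp : (1 - p x) * (1 - p x) = 1 - (2 : ℂ) • p x + p x ^ 2 := by
    rw [ofNat_smul_eq_nsmul, two_nsmul]; ring
  rw [hexp, map_add, map_sub, map_smul, haarIntegral_one, smul_eq_mul] at htot
  linear_combination -2 * htot

end OffDiagonal

/-! ### Rational coefficients of the remainder -/

/-- Coefficient of `1` in the remainder for `x = k`. The four coefficients for `x = k` are stated in
`d = D - 1 ≥ 0`, and the four for `x ≠ k` in `d = D - 2 ≥ 0`: after clearing denominators both
inequalities then say that a polynomial in `d` with nonnegative coefficients is nonnegative. -/
theorem abs_diag_coeff_zero {d : ℝ} (hd : 0 ≤ d) :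
    |(2 * (d + 1) ^ 2 + 6 * (d + 1)) / ((d + 1) * (d + 2) * (d + 3) * (d + 4)) -
      (d + 1) ^ 2 / ((d + 1) ^ 2 * (d + 2) ^ 2) - ((d + 1) ^ 2 - 4 * (d + 1) + 11) / (d + 1) ^ 4| ≤
      100 / (d + 1) ^ 5 := by
  rw [abs_le]
  constructor
  · rw [← sub_nonneg]; field_simp; ring_nf; positivity
  · rw [← sub_nonneg]; field_simp; ring_nf; positivity

/-- Coefficient of `m = |μ(t)|²` for `x = k`. -/
theorem abs_diag_coeff_one {d : ℝ} (hd : 0 ≤ d) :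
    |(4 * (d + 1) + 8) / ((d + 1) * (d + 2) * (d + 3) * (d + 4)) -
      2 * (d + 1) / ((d + 1) ^ 2 * (d + 2) ^ 2) - (2 * (d + 1) - 12) / (d + 1) ^ 4| ≤
      100 / (d + 1) ^ 5 := by
  rw [abs_le]
  constructor
  · rw [← sub_nonneg]; field_simp; ring_nf; positivity
  · rw [← sub_nonneg]; field_simp; ring_nf; positivity

/-- Coefficient of `m²` for `x = k`; the leading terms cancel. -/
theorem abs_diag_coeff_two {d : ℝ} (hd : 0 ≤ d) :
    |1 / ((d + 1) * (d + 2) * (d + 3) * (d + 4)) -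
      1 / ((d + 1) ^ 2 * (d + 2) ^ 2)| ≤ 100 / (d + 1) ^ 5 := by
  rw [abs_le]
  constructor
  · rw [← sub_nonneg]; field_simp; ring_nf; positivity
  · rw [← sub_nonneg]; field_simp; ring_nf; positivity

/-- Coefficient of `|μ(2t)|² + 2 Re[μ(t)²μ(-2t)]` for `x = k`. -/
theorem abs_diag_coeff_three {d : ℝ} (hd : 0 ≤ d) :
    |1 / ((d + 1) * (d + 2) * (d + 3) * (d + 4)) - 1 / (d + 1) ^ 4| ≤ 100 / (d + 1) ^ 5 := by
  rw [abs_le]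
  constructor
  · rw [← sub_nonneg]; field_simp; ring_nf; positivity
  · rw [← sub_nonneg]; field_simp; ring_nf; positivity

/-- Coefficient of `1` in the remainder for `x ≠ k`. -/
theorem abs_offDiag_coeff_zero {d : ℝ} (hd : 0 ≤ d) :
    |2 / ((d + 2) * (d + 1)) * (1 - 2 * (d + 2) / ((d + 2) * (d + 3)) +
        (2 * (d + 2) ^ 2 + 6 * (d + 2)) / ((d + 2) * (d + 3) * (d + 4) * (d + 5))) -
      (d + 2) ^ 4 / ((d + 2) ^ 2 * (d + 1) ^ 2 * (d + 3) ^ 2) -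
      ((d + 2) ^ 2 - 2 * (d + 2) + 4) / (d + 2) ^ 4| ≤ 100 / (d + 2) ^ 5 := by
  rw [abs_le]
  constructor
  · rw [← sub_nonneg]; field_simp; ring_nf; positivity
  · rw [← sub_nonneg]; field_simp; ring_nf; positivity

/-- Coefficient of `m = |μ(t)|²` for `x ≠ k`. -/
theorem abs_offDiag_coeff_one {d : ℝ} (hd : 0 ≤ d) :
    |2 / ((d + 2) * (d + 1)) * (-2 / ((d + 2) * (d + 3)) +
        (4 * (d + 2) + 8) / ((d + 2) * (d + 3) * (d + 4) * (d + 5))) +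
      2 * (d + 2) ^ 2 / ((d + 2) ^ 2 * (d + 1) ^ 2 * (d + 3) ^ 2) + 2 / (d + 2) ^ 4| ≤
      100 / (d + 2) ^ 5 := by
  rw [abs_le]
  constructor
  · rw [← sub_nonneg]; field_simp; ring_nf; positivity
  · rw [← sub_nonneg]; field_simp; ring_nf; positivity

/-- Coefficient of `m²` for `x ≠ k`. -/
theorem abs_offDiag_coeff_two {d : ℝ} (hd : 0 ≤ d) :
    |2 / ((d + 2) * (d + 1)) * (1 / ((d + 2) * (d + 3) * (d + 4) * (d + 5))) -
      1 / ((d + 2) ^ 2 * (d + 1) ^ 2 * (d + 3) ^ 2)| ≤ 100 / (d + 2) ^ 5 := by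
  rw [abs_le]
  constructor
  · rw [← sub_nonneg]; field_simp; ring_nf; positivity
  · rw [← sub_nonneg]; field_simp; ring_nf; positivity

/-- Coefficient of `|μ(2t)|² + 2 Re[μ(t)²μ(-2t)]` for `x ≠ k`, where nothing is subtracted: it is
`O(D⁻⁶)`. -/
theorem abs_offDiag_coeff_three {d : ℝ} (hd : 0 ≤ d) :
    |2 / ((d + 2) * (d + 1)) * (1 / ((d + 2) * (d + 3) * (d + 4) * (d + 5)))| ≤
      100 / (d + 2) ^ 5 := by
  rw [abs_le]
  constructor
  · rw [← sub_nonneg]; field_simp; ring_nf; positivity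
  · rw [← sub_nonneg]; field_simp; ring_nf; positivity

/-! ### Bounds for the remainder -/

theorem abs_combination_le {B c₀ c₁ c₂ c₃ m s w : ℝ} (h₀ : |c₀| ≤ B) (h₁ : |c₁| ≤ B)
    (h₂ : |c₂| ≤ B) (h₃ : |c₃| ≤ B) (hm : 0 ≤ m) (hs : 0 ≤ s) (hw : 2 * |w| ≤ m ^ 2 + s) :
    |c₀ + c₁ * m + c₂ * m ^ 2 + c₃ * (s + 2 * w)| ≤ 3 * B * (1 + m ^ 2 + s) := by
  have hB : 0 ≤ B := (abs_nonneg _).trans h₀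
  have hsw : |s + 2 * w| ≤ m ^ 2 + 2 * s := by
    have := abs_add_le s (2 * w)
    rw [abs_mul, abs_two, abs_of_nonneg hs] at this
    linarith
  have hm1 : m ≤ 1 + m ^ 2 := by nlinarith [sq_nonneg (m - 1)]
  calc |c₀ + c₁ * m + c₂ * m ^ 2 + c₃ * (s + 2 * w)|
      ≤ |c₀| + |c₁| * m + |c₂| * m ^ 2 + |c₃| * |s + 2 * w| := by
        rw [← abs_mul, ← abs_of_nonneg hm, ← abs_mul, ← abs_of_nonneg (sq_nonneg |m|), ← abs_mul,
          abs_of_nonneg hm, abs_of_nonneg (sq_nonneg m)]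
        exact (abs_add_le _ _).trans (add_le_add_left ((abs_add_le _ _).trans
          (add_le_add_left (abs_add_le _ _) _)) _)
    _ ≤ B + B * (1 + m ^ 2) + B * m ^ 2 + B * (m ^ 2 + 2 * s) := by gcongr
    _ ≤ 3 * B * (1 + m ^ 2 + s) := by nlinarith [mul_nonneg hB hs]

/-- Here `P`, `Q` stand for the first and second moments of `Pr(x | ρ(t))`, and `m`, `s`, `w` for
`|μ(t)|²`, `|μ(2t)|²`, `Re[μ(t)²μ(-2t)]`. -/
theorem abs_diag_remainder_le {D m s w P Q : ℝ} (hD : 1 ≤ D) (hm : 0 ≤ m) (hs : 0 ≤ s)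
    (hw : 2 * |w| ≤ m ^ 2 + s) (hP : D * (D + 1) * P = m + D)
    (hQ : D * (D + 1) * (D + 2) * (D + 3) * Q =
      m ^ 2 + 2 * w + s + (4 * D + 8) * m + 2 * D ^ 2 + 6 * D) :
    |Q - P ^ 2 - 1 / D ^ 4 * (D ^ 2 - 4 * D + 11 + m * (2 * D - 12) + s + 2 * w)| ≤
      300 * (1 + m ^ 2 + s) / D ^ 5 := by
  obtain ⟨d, hd, rfl⟩ : ∃ d : ℝ, 0 ≤ d ∧ D = d + 1 := ⟨D - 1, by linarith, by ring⟩
  have hP' : P = (m + (d + 1)) / ((d + 1) * (d + 2)) := by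
    rw [eq_div_iff (by positivity)]; linear_combination hP
  have hQ' : Q = (m ^ 2 + 2 * w + s + (4 * (d + 1) + 8) * m + 2 * (d + 1) ^ 2 + 6 * (d + 1)) /
      ((d + 1) * (d + 2) * (d + 3) * (d + 4)) := by
    rw [eq_div_iff (by positivity)]; linear_combination hQ
  have h := abs_combination_le (abs_diag_coeff_zero hd) (abs_diag_coeff_one hd)
    (abs_diag_coeff_two hd) (abs_diag_coeff_three hd) hm hs hw
  rw [hP', hQ']
  convert h using 1
  · congr 1
    field_simp
    ring
  · ring

/-- As `abs_diag_remainder_le`, with `P'`, `Q'` the first and second moments of `Pr(k | ρ(t))` for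
`k ≠ x`. -/
theorem abs_offDiag_remainder_le {D m s w P Q P' Q' : ℝ} (hD : 2 ≤ D) (hm : 0 ≤ m) (hs : 0 ≤ s)
    (hw : 2 * |w| ≤ m ^ 2 + s) (hP : D * (D + 1) * P = m + D)
    (hQ : D * (D + 1) * (D + 2) * (D + 3) * Q =
      m ^ 2 + 2 * w + s + (4 * D + 8) * m + 2 * D ^ 2 + 6 * D)
    (hP' : (D - 1) * P' = 1 - P) (hQ' : D * (D - 1) * Q' = 2 * (1 - 2 * P + Q)) :
    |Q' - P' ^ 2 - 1 / D ^ 4 * (D ^ 2 - 2 * D + 4 - 2 * m)| ≤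
      300 * (1 + m ^ 2 + s) / D ^ 5 := by
  obtain ⟨d, hd, rfl⟩ : ∃ d : ℝ, 0 ≤ d ∧ D = d + 2 := ⟨D - 2, by linarith, by ring⟩
  have hP₁ : P = (m + (d + 2)) / ((d + 2) * (d + 3)) := by
    rw [eq_div_iff (by positivity)]; linear_combination hP
  have hQ₁ : Q = (m ^ 2 + 2 * w + s + (4 * (d + 2) + 8) * m + 2 * (d + 2) ^ 2 + 6 * (d + 2)) /
      ((d + 2) * (d + 3) * (d + 4) * (d + 5)) := by
    rw [eq_div_iff (by positivity)]; linear_combination hQ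
  have hP₂ : P' = ((d + 2) ^ 2 - m) / ((d + 2) * (d + 1) * (d + 3)) := by
    rw [eq_div_iff (by positivity)]
    linear_combination (d + 2) * (d + 3) * hP' - hP
  have hQ₂ : Q' = 2 / ((d + 2) * (d + 1)) * (1 - 2 * P + Q) := by
    rw [div_mul_eq_mul_div, eq_div_iff (by positivity)]; linear_combination hQ'
  have h := abs_combination_le (abs_offDiag_coeff_zero hd) (abs_offDiag_coeff_one hd)
    (abs_offDiag_coeff_two hd) (abs_offDiag_coeff_three hd) hm hs hw
  rw [hQ₂, hP₂, hP₁, hQ₁]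
  convert h using 1
  · congr 1
    field_simp
    ring
  · ring

/-! ### Outcome probabilities as matrix entries -/

theorem F_mul_F {D : ℕ} (E : Fin D → ℝ) (s t : ℝ) : F E s * F E t = F E (s + t) := by
  rw [F, F, F, Matrix.diagonal_mul_diagonal]
  congr 1
  funext a
  rw [← Complex.exp_add]
  congr 1
  push_cast
  ring

theorem F_zero {D : ℕ} (E : Fin D → ℝ) : F E 0 = 1 := by
  simp [F]

theorem F_conjTranspose {D : ℕ} (E : Fin D → ℝ) (t : ℝ) : (F E t)ᴴ = F E (-t) := by
  rw [F, F, Matrix.diagonal_conjTranspose]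
  congr 1
  funext a
  simp [← Complex.exp_conj]

theorem mu_neg {D : ℕ} (E : Fin D → ℝ) (t : ℝ) : mu E (-t) = star (mu E t) := by
  rw [mu, mu, ← F_conjTranspose, Matrix.trace_conjTranspose]

theorem ketbra_eigenvectorBasis {D : ℕ} {A : Matrix (Fin D) (Fin D) ℂ} (hA : A.IsHermitian)
    (k : Fin D) : ketbra (hA.eigenvectorBasis k) =
      (hA.eigenvectorUnitary : Matrix (Fin D) (Fin D) ℂ) * Matrix.single k k 1 *
        (hA.eigenvectorUnitary : Matrix (Fin D) (Fin D) ℂ)ᴴ := by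
  ext i j
  rw [mul_single_mul_apply]
  rfl

theorem conjEntry_conjTranspose {D : ℕ} (i j : Fin D) (M : Matrix (Fin D) (Fin D) ℂ) (C : U D) :
    conjEntry j i Mᴴ C = star (conjEntry i j M C) := by
  rw [conjEntry_apply, conjEntry_apply, ← Matrix.conjTranspose_apply]
  simp only [Matrix.conjTranspose_mul, Matrix.conjTranspose_conjTranspose, Matrix.mul_assoc]

theorem trace_single_mul_mul_single_mul {D : ℕ} (k x : Fin D) (P Q : Matrix (Fin D) (Fin D) ℂ) :
    Matrix.trace (Matrix.single k k 1 * P * Matrix.single x x 1 * Q) = P k x * Q x k := by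
  rw [Matrix.single_mul_mul_single, Matrix.trace_single_mul]
  simp

/-- The eigenbasis of `A` drops out: `Pr(k | ρ(t)) = (C F(t) C†) k x * (C F(-t) C†) x k`, which is
real because `F(-t) = F(t)†`. -/
theorem ofReal_outcomeProb {D : ℕ} {A : Matrix (Fin D) (Fin D) ℂ} (hA : A.IsHermitian)
    (E : Fin D → ℝ) (t : ℝ) (x k : Fin D) (C : U D) :
    (outcomeProb hA E t x k C : ℂ) =
      (conjEntry k x (F E t) * conjEntry x k (F E (-t))) C := by
  have htrace : Matrix.trace (ketbra (hA.eigenvectorBasis k) *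
      evolvedState (hamiltonian hA E C) (ketbra (hA.eigenvectorBasis x)) t) =
      (conjEntry k x (F E t) * conjEntry x k (F E (-t))) C := by
    have hV := unitary_conjTranspose_mul hA.eigenvectorUnitary
    have hV' : ∀ Z : Matrix (Fin D) (Fin D) ℂ,
        (hA.eigenvectorUnitary : Matrix (Fin D) (Fin D) ℂ)ᴴ *
          ((hA.eigenvectorUnitary : Matrix (Fin D) (Fin D) ℂ) * Z) = Z := fun Z => by
      rw [← Matrix.mul_assoc, hV, Matrix.one_mul]
    rw [evolvedState, evolution_hamiltonian, ketbra_eigenvectorBasis, ketbra_eigenvectorBasis]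
    simp only [Submonoid.coe_mul, Matrix.conjTranspose_mul, Matrix.conjTranspose_conjTranspose,
      Matrix.mul_assoc, hV']
    rw [Matrix.trace_mul_comm]
    simp only [Matrix.mul_assoc, hV, Matrix.mul_one]
    rw [F_conjTranspose, ContinuousMap.mul_apply, conjEntry_apply, conjEntry_apply,
      ← trace_single_mul_mul_single_mul]
    simp only [Matrix.mul_assoc]

  have hreal : ((conjEntry k x (F E t) * conjEntry x k (F E (-t))) C) =
      (Complex.normSq (conjEntry k x (F E t) C) : ℂ) := by
    rw [← Complex.mul_conj, ContinuousMap.mul_apply]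
    congr 1
    rw [← F_conjTranspose, conjEntry_conjTranspose]
    rfl
  rw [outcomeProb, htrace, hreal, Complex.ofReal_re]

theorem continuous_outcomeProb {D : ℕ} {A : Matrix (Fin D) (Fin D) ℂ} (hA : A.IsHermitian)
    (E : Fin D → ℝ) (t : ℝ) (x k : Fin D) : Continuous (outcomeProb hA E t x k) := by
  have : outcomeProb hA E t x k = fun C =>
      ((conjEntry k x (F E t) * conjEntry x k (F E (-t))) C).re := by
    funext C
    rw [← ofReal_outcomeProb hA, Complex.ofReal_re]
  rw [this]
  exact Complex.continuous_re.comp (ContinuousMap.continuous _)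

theorem ofReal_integral_outcomeProb_pow {D : ℕ} {A : Matrix (Fin D) (Fin D) ℂ}
    (hA : A.IsHermitian) (E : Fin D → ℝ) (t : ℝ) (x k : Fin D) (n : ℕ) :
    ((∫ C, outcomeProb hA E t x k C ^ n ∂haar D : ℝ) : ℂ) =
      haarIntegral D ((conjEntry k x (F E t) * conjEntry x k (F E (-t))) ^ n) := by
  rw [← integral_complex_ofReal, haarIntegral_apply]
  congr 1 with C
  rw [ContinuousMap.pow_apply, ← ofReal_outcomeProb hA, Complex.ofReal_pow]

/-- The exponent `1` lets the moment formulas below apply to both integrals. -/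
theorem variance_outcomeProb {D : ℕ} {A : Matrix (Fin D) (Fin D) ℂ} (hA : A.IsHermitian)
    (E : Fin D → ℝ) (t : ℝ) (x k : Fin D) :
    Var[outcomeProb hA E t x k; haar D] = ∫ C, outcomeProb hA E t x k C ^ 2 ∂haar D -
      (∫ C, outcomeProb hA E t x k C ^ 1 ∂haar D) ^ 2 := by
  rw [variance_eq_sub]
  · simp
  · exact (continuous_outcomeProb hA E t x k).memLp_of_hasCompactSupport
      (HasCompactSupport.of_compactSpace _)

theorem integral_outcomeProb_diag {D : ℕ} {A : Matrix (Fin D) (Fin D) ℂ} (hA : A.IsHermitian)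
    (E : Fin D → ℝ) (t : ℝ) (x : Fin D) :
    (D * (D + 1) : ℝ) * ∫ C, outcomeProb hA E t x x C ^ 1 ∂haar D = ‖mu E t‖ ^ 2 + D := by
  have hF : F E t * F E (-t) = 1 := by rw [F_mul_F, add_neg_cancel, F_zero]
  apply Complex.ofReal_injective
  push_cast
  rw [ofReal_integral_outcomeProb_pow, pow_one, haarIntegral_diag_second_moment x hF,
    ← mu, ← mu, mu_neg, Complex.star_def, Complex.mul_conj']

theorem integral_outcomeProb_sq_diag {D : ℕ} {A : Matrix (Fin D) (Fin D) ℂ}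
    (hA : A.IsHermitian) (E : Fin D → ℝ) (t : ℝ) (x : Fin D) :
    (D * (D + 1) * (D + 2) * (D + 3) : ℝ) * ∫ C, outcomeProb hA E t x x C ^ 2 ∂haar D =
      (‖mu E t‖ ^ 2) ^ 2 + 2 * (mu E t ^ 2 * mu E (-2 * t)).re + ‖mu E (2 * t)‖ ^ 2 +
        (4 * D + 8) * ‖mu E t‖ ^ 2 + 2 * D ^ 2 + 6 * D := by
  have hF : F E t * F E (-t) = 1 := by rw [F_mul_F, add_neg_cancel, F_zero]
  apply Complex.ofReal_injective
  push_cast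
  rw [ofReal_integral_outcomeProb_pow, haarIntegral_diag_fourth_moment x hF, F_mul_F, F_mul_F,
    show t + t = 2 * t by ring, show -t + -t = -(2 * t) by ring, ← mu, ← mu, ← mu, ← mu,
    neg_mul, mu_neg, mu_neg, ← Complex.mul_conj', ← Complex.mul_conj', Complex.re_eq_add_conj]
  simp only [Complex.star_def, map_mul, map_pow, Complex.conj_conj]
  ring

theorem two_mul_abs_re_le (a b : ℂ) : 2 * |(a ^ 2 * b).re| ≤ (‖a‖ ^ 2) ^ 2 + ‖b‖ ^ 2 := by
  have h := Complex.abs_re_le_norm (a ^ 2 * b)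
  rw [norm_mul, norm_pow] at h
  nlinarith [sq_nonneg (‖a‖ ^ 2 - ‖b‖)]

theorem integral_outcomeProb_offDiag {D : ℕ} {A : Matrix (Fin D) (Fin D) ℂ}
    (hA : A.IsHermitian) (E : Fin D → ℝ) (t : ℝ) {x k : Fin D} (hk : k ≠ x) :
    (D - 1 : ℝ) * ∫ C, outcomeProb hA E t x k C ^ 1 ∂haar D =
      1 - ∫ C, outcomeProb hA E t x x C ^ 1 ∂haar D := by
  have hF : F E (-t) * F E t = 1 := by rw [F_mul_F, neg_add_cancel, F_zero]
  apply Complex.ofReal_injective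
  push_cast
  rw [ofReal_integral_outcomeProb_pow, ofReal_integral_outcomeProb_pow, pow_one, pow_one,
    haarIntegral_offDiag_second_moment hF hk]

theorem integral_outcomeProb_sq_offDiag {D : ℕ} {A : Matrix (Fin D) (Fin D) ℂ}
    (hA : A.IsHermitian) (E : Fin D → ℝ) (t : ℝ) {x k : Fin D} (hk : k ≠ x) :
    (D * (D - 1) : ℝ) * ∫ C, outcomeProb hA E t x k C ^ 2 ∂haar D =
      2 * (1 - 2 * ∫ C, outcomeProb hA E t x x C ^ 1 ∂haar D +
        ∫ C, outcomeProb hA E t x x C ^ 2 ∂haar D) := by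
  have hF : F E (-t) * F E t = 1 := by rw [F_mul_F, neg_add_cancel, F_zero]
  apply Complex.ofReal_injective
  push_cast
  simp only [ofReal_integral_outcomeProb_pow]
  rw [haarIntegral_offDiag_fourth_moment hF hk, pow_one]

end HaarVariance

end

open HaarVariance in
/-- The variance, over the Haar measure on the unitary group of change of basis matrices `C`, of
the outcome probability `Pr(k | ρ(t))`. The remainder is `O(D⁻⁵)` with respect to `D`, its
coefficient being bounded by a universal constant times a polynomial in `|μ(t)|` and `|μ(2t)|`. -/
theorem lemma2 :
    ∃ K : ℝ, ∀ (D : ℕ) (A : Matrix (Fin D) (Fin D) ℂ) (hA : A.IsHermitian),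
      Function.Injective hA.eigenvalues →
      ∀ (E : Fin D → ℝ) (t : ℝ) (x k : Fin D) (δ : ℝ), δ = (if x = k then 1 else 0) →
        |Var[fun C : U D => outcomeProb hA E t x k C; haar D] -
            1 / (D : ℝ) ^ 4 *
              ((D : ℝ) ^ 2 - 2 * D + 4 + (7 - 2 * D) * δ
                + ‖mu E t‖ ^ 2 * (2 * D * δ - 10 * δ - 2)
                + δ * ‖mu E (2 * t)‖ ^ 2
                + 2 * δ * (mu E t ^ 2 * mu E (-2 * t)).re)|
          ≤ K * (1 + ‖mu E t‖ ^ 4 + ‖mu E (2 * t)‖ ^ 2) / (D : ℝ) ^ 5 := by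
  refine ⟨300, fun D A hA _ E t x k δ hδ => ?_⟩
  have hw : 2 * |(mu E t ^ 2 * mu E (-2 * t)).re| ≤ (‖mu E t‖ ^ 2) ^ 2 + ‖mu E (2 * t)‖ ^ 2 := by
    have h := two_mul_abs_re_le (mu E t) (mu E (-2 * t))
    rwa [show -2 * t = -(2 * t) by ring, mu_neg, norm_star, ← mu_neg, ← neg_mul] at h
  have hP := integral_outcomeProb_diag hA E t x
  have hQ := integral_outcomeProb_sq_diag hA E t x
  rw [variance_outcomeProb, show ‖mu E t‖ ^ 4 = (‖mu E t‖ ^ 2) ^ 2 by ring]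
  split_ifs at hδ with hxk
  · subst hxk hδ
    have hD : (1 : ℝ) ≤ D := by exact_mod_cast x.pos
    convert abs_diag_remainder_le hD (sq_nonneg _) (sq_nonneg _) hw hP hQ using 4
    ring
  · subst hδ
    have hD : (2 : ℝ) ≤ D := by
      have : 2 ≤ D := by
        by_contra! h
        exact hxk (Fin.ext (by omega))
      exact_mod_cast this
    have hkx : k ≠ x := fun h => hxk h.symm
    convert abs_offDiag_remainder_le hD (sq_nonneg _) (sq_nonneg _) hw hP hQ
      (integral_outcomeProb_offDiag hA E t hkx) (integral_outcomeProb_sq_offDiag hA E t hkx)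
      using 4
    ring
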